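/- All topological spaces are assumed to be Hausdorff. A topological inverse semigroup is an inverse semigroup with a Hausdorff topology in which multiplication and inversion are continuous. A semigroup $S$ with zero $0$ is $0$-simple if $S^2\neq\{0\}$ and $\{0\}$ is the only proper two-sided ideal of $S$. For a nonempty set $I_\lambda$ of cardinality $\lambda$ and a group $H$, the Brandt $\lambda$-extension $B_\lambda(H)$ is the set $(I_\lambda\times H\times I_\lambda)\cup\{0\}$ with the multiplication $(\alpha,a,\beta)(\gamma,b,\delta)=(\alpha,ab,\delta)$ if $\beta=\gamma$, and with all other products equal to $0$. If $H$ is a topological group, a topological Brandt $\lambda$-extension of $H$ in the class of topological inverse semigroups is $B_\lambda(H)$ with a topology that makes it a topological inverse semigroup and that, for some $\alpha\in I_\lambda$, induces on $\{(\alpha,h,\alpha): h\in H\}$, identified with $H$, the topology of $H$. **Theorem.** Let $S$ be a $0$-simple countably compact topological inverse semigroup. Then there exist a nonempty finite set $I_\lambda$ of cardinality $\lambda$ and a countably compact topological group $H$ such that $S$ is topologically isomorphic to a topological Brandt $\lambda$-extension $B_\lambda(H)$ of $H$ in the class of topological inverse semigroups. Moreover, $S$ is homeomorphic to the topological sum of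 a single point and finitely many copies of $H$, namely $\lambda^2$ copies, one for each pair $(\alpha,\beta)\in I_\lambda\times I_\lambda$. -/

import Mathlib

universe u v

/-- `y` is an inverse of `x` in the sense of semigroup theory. -/
def IsSemigroupInverse {S : Type u} [Semigroup S] (x y : S) : Prop :=
  x * y * x = x ∧ y * x * y = y

/-- An inverse semigroup: every element has exactly one inverse. -/
def IsInverseSemigroup (S : Type u) [Semigroup S] : Prop :=
  ∀ x : S, ∃! y : S, IsSemigroupInverse x y

/-- A (Hausdorff) topological inverse semigroup: an inverse semigroup with a Hausdorff topology in
which the multiplication and the inversion `x ↦ x⁻¹` are continuous. In an inverse semigroup the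
map `inv` below is unique. -/
structure IsTopologicalInverseSemigroup (S : Type u) [Semigroup S] [TopologicalSpace S] :
    Prop where
  t2 : T2Space S
  inverse : IsInverseSemigroup S
  continuous_mul : Continuous fun p : S × S => p.1 * p.2
  continuous_inv : ∃ inv : S → S, (∀ x, IsSemigroupInverse x (inv x)) ∧ Continuous inv

/-- A nonempty subset closed under multiplication by arbitrary elements on both sides. -/
def IsTwoSidedSemigroupIdeal {S : Type u} [Semigroup S] (A : Set S) : Prop :=
  A.Nonempty ∧ ∀ a ∈ A, ∀ s : S, s * a ∈ A ∧ a * s ∈ A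

/-- A semigroup `S` with zero is `0`-simple if `S² ≠ {0}` and `{0}` is the only proper two-sided
ideal of `S`. -/
def IsZeroSimple (S : Type u) [SemigroupWithZero S] : Prop :=
  (∃ x y : S, x * y ≠ 0) ∧
    ∀ A : Set S, IsTwoSidedSemigroupIdeal A → A = {0} ∨ A = Set.univ

/-- The underlying set `I × M × I ∪ {0}` of the Brandt `|I|`-extension of a monoid `M`. (For a
semigroup with identity, adjoining an identity changes nothing, that is `M¹ = M`.) -/
inductive BrandtExt (I : Type v) (M : Type u) : Type (max u v)
  | zero : BrandtExt I M
  | triple (α : I) (a : M) (β : I) : BrandtExt I M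

namespace BrandtExt

variable {I : Type v} {M : Type u}

open Classical in
/-- `(α, a, β) * (γ, b, δ)` is `(α, a * b, δ)` if `β = γ` and `0` otherwise; all products with `0`
are `0`. -/
protected noncomputable def mul [Mul M] : BrandtExt I M → BrandtExt I M → BrandtExt I M
  | triple α a β, triple γ b δ => if β = γ then triple α (a * b) δ else zero
  | _, _ => zero

noncomputable instance [Monoid M] : SemigroupWithZero (BrandtExt I M) where
  mul := BrandtExt.mul
  zero := zero
  zero_mul x := by cases x <;> rfl
  mul_zero x := by cases x <;> rfl
  mul_assoc x y z := by
    change BrandtExt.mul (BrandtExt.mul x y) z = BrandtExt.mul x (BrandtExt.mul y z)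
    cases x <;> cases y <;> cases z <;> simp only [BrandtExt.mul] <;>
      split_ifs <;> simp_all [mul_assoc]

end BrandtExt

/-- The given topology on `BrandtExt I M` makes it a topological Brandt `|I|`-extension of the
topological monoid `M` in the class of topological inverse semigroups: both belong to this class,
and for some `α` the topology induced on `{(α, a, α) | a ∈ M}`, identified with `M`, is that
of `M`. -/
structure IsTopologicalBrandtExt (I : Type v) (M : Type u) [Monoid M] [TopologicalSpace M]
    [TopologicalSpace (BrandtExt I M)] : Prop where
  base : IsTopologicalInverseSemigroup M
  total : IsTopologicalInverseSemigroup (BrandtExt I M)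
  induced : ∃ α : I, Topology.IsEmbedding fun a : M => BrandtExt.triple α a α

open Filter Topology

/-! Countable compactness makes every sequence cluster, and identities holding along a sequence pass
to its cluster points (`MapClusterPt.eq_of_eventuallyEq`). This rules out bicyclic behaviour
(`inv_mul_eq_of_mul_inv_eq`), so by 0-simplicity every nonzero idempotent is minimal among the
nonzero ones; distinct idempotents are then orthogonal, and any two nonzero ones are linked by some
`p` with `p * p⁻¹ = f`, `p⁻¹ * p = e`. A second cluster argument shows that there are finitely many
(`finite_nonzero_idem`). Fix a nonzero idempotent `f` with maximal subgroup `H`, and link it by `r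
i` to each nonzero idempotent. Then `(i, h, j) ↦ (r i)⁻¹ * h * r j` is an isomorphism from the
Brandt extension, with `x ↦ r i * x * (r j)⁻¹` recovering `h`. `H` is closed and misses `0`, so each
block is closed; having finitely many blocks gives the topological sum. -/

/-- Inverse semigroups with the inversion as part of the notation. -/
class InverseSemigroup (S : Type*) [Semigroup S] [Inv S] : Prop where
  mul_inv_mul : ∀ x : S, x * x⁻¹ * x = x
  inv_mul_inv : ∀ x : S, x⁻¹ * x * x⁻¹ = x⁻¹
  eq_inv : ∀ x y : S, x * y * x = x → y * x * y = y → y = x⁻¹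

/-! ### Idempotents and inverses of products -/

namespace InverseSemigroup

variable {S : Type*} [Semigroup S] [Inv S] [InverseSemigroup S]

theorem inv_inv' (x : S) : x⁻¹⁻¹ = x :=
  (eq_inv _ _ (inv_mul_inv x) (mul_inv_mul x)).symm

theorem inv_of_idem {e : S} (he : e * e = e) : e⁻¹ = e :=
  (eq_inv e e (by simp only [he]) (by simp only [he])).symm

/-- If `x` is the inverse of `e * f`, so is `f * x * e`; uniqueness gives `x = f * x * e`, which
makes `x` idempotent, hence self-inverse and equal to `e * f`. -/
theorem idem_mul_idem {e f : S} (he : e * e = e) (hf : f * f = f) :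
    e * f * (e * f) = e * f := by
  have h1 := mul_inv_mul (e * f)
  have h2 := inv_mul_inv (e * f)
  generalize hx : (e * f)⁻¹ = x at h1 h2
  have h3 : f * x * e = x :=
    hx ▸ eq_inv (e * f) (f * x * e) (by grind) (by grind)
  have h4 : x * x = x := by grind
  have h5 : e * f = x := by
    rw [← inv_of_idem h4, ← hx, inv_inv']
  rw [h5, h4]

theorem idem_comm {e f : S} (he : e * e = e) (hf : f * f = f) : e * f = f * e := by
  have h1 := idem_mul_idem he hf
  have h2 := idem_mul_idem hf he
  have h3 : f * e = (e * f)⁻¹ := eq_inv _ _ (by grind) (by grind)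
  rw [h3, inv_of_idem h1]

theorem mul_inv_idem (x : S) : x * x⁻¹ * (x * x⁻¹) = x * x⁻¹ := by
  rw [← mul_assoc, mul_inv_mul]

theorem inv_mul_idem (x : S) : x⁻¹ * x * (x⁻¹ * x) = x⁻¹ * x := by
  rw [← mul_assoc, inv_mul_inv]

theorem mul_inv_rev' (x y : S) : (x * y)⁻¹ = y⁻¹ * x⁻¹ := by
  have h := idem_comm (inv_mul_idem x) (mul_inv_idem y)
  have h1 := mul_inv_mul x
  have h2 := mul_inv_mul y
  have h3 := inv_mul_inv x
  have h4 := inv_mul_inv y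
  refine (eq_inv _ _ ?_ ?_).symm
  · calc x * y * (y⁻¹ * x⁻¹) * (x * y) = x * ((y * y⁻¹) * (x⁻¹ * x)) * y := by
          simp only [mul_assoc]
      _ = (x * x⁻¹ * x) * (y * y⁻¹ * y) := by rw [← h]; simp only [mul_assoc]
      _ = x * y := by rw [h1, h2]
  · calc y⁻¹ * x⁻¹ * (x * y) * (y⁻¹ * x⁻¹) = y⁻¹ * ((x⁻¹ * x) * (y * y⁻¹)) * x⁻¹ := by
          simp only [mul_assoc]
      _ = (y⁻¹ * y * y⁻¹) * (x⁻¹ * x * x⁻¹) := by rw [h]; simp only [mul_assoc]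
      _ = y⁻¹ * x⁻¹ := by rw [h3, h4]

end InverseSemigroup

/-! ### Cluster points and the exclusion of bicyclic subsemigroups -/

theorem MapClusterPt.eq_of_eventuallyEq {ι X Y : Type*} [TopologicalSpace X] [TopologicalSpace Y]
    [T2Space Y] {l : Filter ι} {u : ι → X} {x : X} {g h : X → Y} (hx : MapClusterPt x l u)
    (hg : Continuous g) (hh : Continuous h) (H : ∀ᶠ n in l, g (u n) = h (u n)) : g x = h x := by
  by_contra hne
  have hn : {y | g y ≠ h y} ∈ 𝓝 x := (isOpen_ne_fun hg hh).mem_nhds hne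
  obtain ⟨n, h1, h2⟩ := ((hx.frequently hn).and_eventually H).exists
  exact h1 h2

theorem exists_mapClusterPt_of_countablyCompact {X : Type*} [TopologicalSpace X]
    [CountablyCompactSpace X] (u : ℕ → X) : ∃ x, MapClusterPt x atTop u := by
  obtain ⟨x, -, hx⟩ := CountablyCompactSpace.isCountablyCompact_univ.seq_clusterPt u (by simp)
  exact ⟨x, hx⟩

namespace InverseSemigroup

section Topological

variable {S : Type*} [Semigroup S] [Inv S] [InverseSemigroup S] [TopologicalSpace S] [T2Space S]
  [CountablyCompactSpace S] [ContinuousMul S] [ContinuousInv S]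

/-- A countably compact topological inverse semigroup contains no bicyclic subsemigroup. -/
theorem inv_mul_eq_of_mul_inv_eq {p f : S} (hp : p * p⁻¹ = f) (hpf : p * f = p) :
    p⁻¹ * p = f := by
  have hf : f * f = f := hp ▸ mul_inv_idem p
  have hfp : f * p = p := hp ▸ mul_inv_mul p
  -- `u n` is `p ^ n`, with `f` as zeroth power; the idempotents `e n = p⁻ⁿ * pⁿ` below decrease.
  obtain ⟨u, u0, us⟩ : ∃ u : ℕ → S, u 0 = f ∧ ∀ n, u (n + 1) = u n * p :=
    ⟨fun n => n.rec f fun _ y => y * p, rfl, fun _ => rfl⟩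
  have huf : ∀ n, u n * f = u n := by
    rintro (_ | n)
    · rw [u0, hf]
    · rw [us, mul_assoc, hpf]
  have huu : ∀ n, u n * (u n)⁻¹ = f := by
    intro n
    induction n with
    | zero => rw [u0, inv_of_idem hf, hf]
    | succ n ih => rw [us, mul_inv_rev', mul_assoc, ← mul_assoc p, hp, ← mul_assoc, huf, ih]
  obtain ⟨e, he⟩ : ∃ e : ℕ → S, ∀ n, e n = (u n)⁻¹ * u n := ⟨_, fun _ => rfl⟩
  have hes : ∀ n, e (n + 1) = p⁻¹ * e n * p := fun n => by
    rw [he, us, mul_inv_rev', he]; simp only [mul_assoc]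
  have hef : ∀ n, e n * f = e n := fun n => by rw [he, mul_assoc, huf]
  have hei : ∀ n, e n * e n = e n := fun n => by rw [he]; exact inv_mul_idem _
  have hmono : ∀ n, e (n + 1) * e n = e (n + 1) := by
    intro n
    induction n with
    | zero =>
      have : e 0 = f := by rw [he, u0, inv_of_idem hf, hf]
      rw [this, hef]
    | succ n ih =>
      calc e (n + 2) * e (n + 1) = p⁻¹ * (e (n + 1) * (p * p⁻¹) * e n) * p := by
            rw [hes (n + 1), hes n]; simp only [mul_assoc]
        _ = e (n + 2) := by rw [hp, hef, ih, hes (n + 1)]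
  have hanti : ∀ n k, e (n + k) * e n = e (n + k) := by
    intro n k
    induction k with
    | zero => exact hei n
    | succ k ih => rw [← add_assoc, ← hmono (n + k), mul_assoc, ih]
  obtain ⟨x, hx⟩ := exists_mapClusterPt_of_countablyCompact u
  have hxf : x * x⁻¹ = f :=
    hx.eq_of_eventuallyEq (g := fun y => y * y⁻¹) (h := fun _ => f) (by fun_prop) (by fun_prop)
      (.of_forall huu)
  have hle : ∀ c, MapClusterPt c atTop e → ∀ n, c * e n = c := fun c hc n =>
    hc.eq_of_eventuallyEq (g := fun y => y * e n) (h := fun y => y) (by fun_prop) (by fun_prop)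
      ((eventually_ge_atTop n).mono fun m hm => by
        obtain ⟨k, rfl⟩ := Nat.exists_eq_add_of_le hm; exact hanti n k)
  have hidem : ∀ c, MapClusterPt c atTop e → c * c = c := fun c hc =>
    hc.eq_of_eventuallyEq (g := fun y => y * y) (h := fun y => y) (by fun_prop) (by fun_prop)
      (.of_forall hei)
  -- Each cluster point lies below every `e n`, hence below every other cluster point.
  have huniq : ∀ c d, MapClusterPt c atTop e → MapClusterPt d atTop e → c = d := by
    have key : ∀ c d, MapClusterPt c atTop e → MapClusterPt d atTop e → c * d = c :=
      fun c d hc hd => hd.eq_of_eventuallyEq (g := fun y => c * y) (h := fun _ => c)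
        (by fun_prop) (by fun_prop) (.of_forall (hle c hc))
    intro c d hc hd
    rw [← key c d hc hd, idem_comm (hidem c hc) (hidem d hd), key d c hd hc]
  have hc : MapClusterPt (x⁻¹ * x) atTop e := by
    have := hx.continuousAt_comp (f := fun y => y⁻¹ * y) (by fun_prop)
    exact (funext he : e = _) ▸ this
  generalize hcx : x⁻¹ * x = c at hc
  have hxc : x * c = x := by rw [← hcx, ← mul_assoc, mul_inv_mul]
  -- Conjugation by `p` shifts `e`, so it fixes the unique cluster point. Hence `c` commutes with
  -- `p`, with every `u n`, and with `x`.
  have hconj : p⁻¹ * c * p = c := by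
    refine huniq _ _ (MapClusterPt.of_comp (φ := fun n : ℕ => n + 1) (tendsto_add_atTop_nat 1) ?_) hc
    have := hc.continuousAt_comp (f := fun y => p⁻¹ * y * p) (by fun_prop)
    exact (funext hes : e ∘ (fun n => n + 1) = _) ▸ this
  have hcf := idem_comm (hidem c hc) hf
  have hcf' : c * f = c :=
    hc.eq_of_eventuallyEq (g := fun y => y * f) (h := fun y => y) (by fun_prop) (by fun_prop)
      (.of_forall hef)
  have hcp : c * p = p * c := by
    calc c * p = f * c * p := by rw [← hcf, hcf']
      _ = p * (p⁻¹ * c * p) := by rw [← hp]; simp only [mul_assoc]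
      _ = p * c := by rw [hconj]
  have hcu : ∀ n, c * u n = u n * c := by
    intro n
    induction n with
    | zero => rw [u0, hcf]
    | succ n ih => rw [us, ← mul_assoc, ih, mul_assoc, hcp, mul_assoc]
  have hcx' : c * x = x * c :=
    hx.eq_of_eventuallyEq (g := fun y => c * y) (h := fun y => y * c) (by fun_prop) (by fun_prop)
      (.of_forall hcu)
  -- Now `c * x = x * c = x`, so `c` fixes `x * x⁻¹ = f`. The decreasing chain from `f` down to `c`
  -- is therefore constant.
  have hfc : f = c := by
    rw [← hcf', ← hxf, ← mul_assoc, hcx', hxc]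
  have he1 : e 1 = p⁻¹ * p := by
    rw [he, us, u0, hfp]
  have h1 := hle c hc 1
  rw [← he1, ← hef 1, idem_comm (hei 1) hf, hfc, h1]

end Topological

/-! ### Nonzero idempotents of a 0-simple semigroup -/

section Zero

variable {S : Type*} [SemigroupWithZero S] [Inv S] [InverseSemigroup S]

theorem exists_mul_mul_eq (h0 : IsZeroSimple S) {a : S} (ha : a ≠ 0) (b : S) :
    ∃ s t, s * a * t = b := by
  have hA : IsTwoSidedSemigroupIdeal {b : S | ∃ s t, s * a * t = b} := by
    refine ⟨⟨0, 0, 0, by simp⟩, ?_⟩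
    rintro _ ⟨s, t, rfl⟩ c
    exact ⟨⟨c * s, t, by simp only [mul_assoc]⟩, ⟨s, t * c, by simp only [mul_assoc]⟩⟩
  have hmem : a ∈ {b : S | ∃ s t, s * a * t = b} :=
    ⟨a * a⁻¹, a⁻¹ * a, by rw [mul_inv_mul, ← mul_assoc, mul_inv_mul]⟩
  rcases h0.2 _ hA with h | h
  · rw [h] at hmem
    exact absurd hmem ha
  · exact (h ▸ Set.mem_univ b : b ∈ {b : S | ∃ s t, s * a * t = b})

theorem exists_mul_inv_eq_and_mul_eq (h0 : IsZeroSimple S) {e f : S} (he : e * e = e)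
    (hf : f * f = f) (he0 : e ≠ 0) : ∃ p, p * p⁻¹ = f ∧ p * e = p := by
  obtain ⟨s, t, hst⟩ := exists_mul_mul_eq h0 he0 f
  -- The witness is `p = f * s * e`: it has a right factor giving `f`, which forces `p * p⁻¹ = f`.
  have hxy : f * s * e * (e * t * f) = f := by
    calc f * s * e * (e * t * f) = f * (s * (e * e) * t) * f := by simp only [mul_assoc]
      _ = f := by rw [he, hst, hf, hf]
  have hfx : f * (f * s * e) = f * s * e := by simp only [← mul_assoc, hf]
  have hxe : f * s * e * e = f * s * e := by rw [mul_assoc, he]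
  generalize f * s * e = x at hxy hfx hxe
  refine ⟨x, ?_, hxe⟩
  have h1 : x * x⁻¹ * f = f := by
    conv_lhs => rw [← hxy]
    rw [← mul_assoc, mul_inv_mul, hxy]
  rw [← h1, idem_comm (mul_inv_idem x) hf, ← mul_assoc, hfx]

variable [TopologicalSpace S] [T2Space S] [CountablyCompactSpace S] [ContinuousMul S]
  [ContinuousInv S]

/-- The link `p` from `f` into `e ≤ f` satisfies `p * f = p`, so excluding the bicyclic case gives
`p⁻¹ * p = f`, while `p * e = p`. -/
theorem eq_of_idem_mul_eq (h0 : IsZeroSimple S) {e f : S} (he : e * e = e)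
    (hf : f * f = f) (he0 : e ≠ 0) (hef : f * e = e) : e = f := by
  obtain ⟨p, hp, hpe⟩ := exists_mul_inv_eq_and_mul_eq h0 he hf he0
  have hpf : p * f = p := by rw [← hpe, mul_assoc, idem_comm he hf, hef]
  have := inv_mul_eq_of_mul_inv_eq hp hpf
  rw [← hef, ← this, mul_assoc, hpe]

theorem idem_mul_eq_zero (h0 : IsZeroSimple S) {e f : S} (he : e * e = e)
    (hf : f * f = f) (hef : e ≠ f) : e * f = 0 := by
  by_contra hne
  have hi := idem_mul_idem he hf
  refine hef ((eq_of_idem_mul_eq h0 hi he hne ?_).symm.trans (eq_of_idem_mul_eq h0 hi hf hne ?_))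
  · rw [← mul_assoc, he]
  · rw [idem_comm he hf, ← mul_assoc, hf]

theorem exists_mul_inv_eq_and_inv_mul_eq (h0 : IsZeroSimple S) {e f : S} (he : e * e = e)
    (hf : f * f = f) (he0 : e ≠ 0) (hf0 : f ≠ 0) : ∃ p, p * p⁻¹ = f ∧ p⁻¹ * p = e := by
  obtain ⟨p, hp, hpe⟩ := exists_mul_inv_eq_and_mul_eq h0 he hf he0
  refine ⟨p, hp, eq_of_idem_mul_eq h0 (inv_mul_idem p) he (fun h => hf0 ?_) ?_⟩
  · rw [← hp, ← mul_inv_mul p, mul_assoc p, h, mul_zero, zero_mul]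
  · rw [idem_comm he (inv_mul_idem p), mul_assoc, hpe]

theorem finite_nonzero_idem (h0 : IsZeroSimple S) : {e : S | e * e = e ∧ e ≠ 0}.Finite := by
  by_contra hinf
  let e : ℕ ↪ {e : S | e * e = e ∧ e ≠ 0} := Set.Infinite.natEmbedding _ hinf
  have hmul : ∀ m n, m ≠ n → (e m : S) * e n = 0 := fun m n h =>
    idem_mul_eq_zero h0 (e m).2.1 (e n).2.1 fun h' => h (e.injective (Subtype.ext h'))
  choose x hxf hxe using fun n =>
    exists_mul_inv_eq_and_inv_mul_eq h0 (e n).2.1 (e 0).2.1 (e n).2.2 (e 0).2.2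
  obtain ⟨y, hy⟩ := exists_mapClusterPt_of_countablyCompact x
  have hyf : y * y⁻¹ = e 0 :=
    hy.eq_of_eventuallyEq (g := fun z => z * z⁻¹) (h := fun _ => (e 0 : S)) (by fun_prop)
      (by fun_prop) (.of_forall hxf)
  -- For `m > n`, `x m` absorbs `e m` on the right, and `e m` is orthogonal to `e n`.
  have hyx : ∀ n, y * (e n : S) = 0 := fun n =>
    hy.eq_of_eventuallyEq (g := fun z => z * (e n : S)) (h := fun _ => (0 : S)) (by fun_prop)
      (by fun_prop) ((eventually_gt_atTop n).mono fun m hm => by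
        rw [← mul_inv_mul (x m), mul_assoc (x m), hxe, mul_assoc, hmul m n hm.ne', mul_zero])
  have hyy : y * (y⁻¹ * y) = 0 :=
    hy.eq_of_eventuallyEq (g := fun z => y * (z⁻¹ * z)) (h := fun _ => (0 : S)) (by fun_prop)
      (by fun_prop) (.of_forall fun n => by rw [hxe, hyx])
  rw [← mul_assoc, mul_inv_mul] at hyy
  exact (e 0).2.2 (by rw [← hyf, hyy, zero_mul])

end Zero

/-! ### Maximal subgroups as topological groups -/

/-- The maximal subgroup of an inverse semigroup at an idempotent. -/
@[ext]
structure MaximalSubgroup {S : Type*} [Semigroup S] [Inv S] (f : {e : S // e * e = e}) where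
  /-- The underlying element of the semigroup. -/
  val : S
  mul_inv : val * val⁻¹ = f
  inv_mul : val⁻¹ * val = f

namespace MaximalSubgroup

variable {S : Type*} [Semigroup S] [Inv S] {f : {e : S // e * e = e}}

theorem val_injective : Function.Injective (val (f := f)) := fun _ _ => MaximalSubgroup.ext

section Algebra

variable [InverseSemigroup S]

theorem idem_mul (x : MaximalSubgroup f) : (f : S) * x.val = x.val := by
  rw [← x.mul_inv, mul_inv_mul]

theorem mul_idem (x : MaximalSubgroup f) : x.val * f = x.val := by
  rw [← x.inv_mul, ← mul_assoc, mul_inv_mul]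

instance : Group (MaximalSubgroup f) :=
  letI : Mul (MaximalSubgroup f) := ⟨fun x y => ⟨x.val * y.val, by
    rw [mul_inv_rev', mul_assoc, ← mul_assoc y.val, y.mul_inv, ← mul_assoc, mul_idem, x.mul_inv], by
    rw [mul_inv_rev', mul_assoc, ← mul_assoc _ x.val, x.inv_mul, idem_mul, y.inv_mul]⟩⟩
  letI : Inv (MaximalSubgroup f) := ⟨fun x => ⟨x.val⁻¹, by
    rw [inv_inv', x.inv_mul], by rw [inv_inv', x.mul_inv]⟩⟩
  letI : One (MaximalSubgroup f) := ⟨⟨f, by rw [inv_of_idem f.2, f.2], by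
    rw [inv_of_idem f.2, f.2]⟩⟩
  Group.ofLeftAxioms (fun x y z => MaximalSubgroup.ext (mul_assoc x.val y.val z.val))
    (fun x => MaximalSubgroup.ext (idem_mul x)) (fun x => MaximalSubgroup.ext x.inv_mul)

theorem val_mul (x y : MaximalSubgroup f) : (x * y).val = x.val * y.val := rfl

end Algebra

variable [TopologicalSpace S]

instance : TopologicalSpace (MaximalSubgroup f) := .induced val inferInstance

theorem isEmbedding_val : IsEmbedding (val (f := f)) := ⟨⟨rfl⟩, val_injective⟩

@[fun_prop]
theorem continuous_val : Continuous (val (f := f)) := isEmbedding_val.continuous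

theorem isTopologicalGroup [InverseSemigroup S] [ContinuousMul S] [ContinuousInv S] :
    IsTopologicalGroup (MaximalSubgroup f) where
  continuous_mul := isEmbedding_val.continuous_iff.2
    ((continuous_val.comp continuous_fst).mul (continuous_val.comp continuous_snd))
  continuous_inv := isEmbedding_val.continuous_iff.2 continuous_val.inv

variable [T2Space S]

theorem t2Space : T2Space (MaximalSubgroup f) := isEmbedding_val.t2Space

variable [ContinuousMul S] [ContinuousInv S]

theorem isClosedEmbedding_val : IsClosedEmbedding (val (f := f)) := by
  refine ⟨isEmbedding_val, ?_⟩
  have : Set.range (val (f := f)) = {x | x * x⁻¹ = (f : S)} ∩ {x | x⁻¹ * x = (f : S)} := by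
    ext x
    exact ⟨by rintro ⟨y, rfl⟩; exact ⟨y.mul_inv, y.inv_mul⟩, fun h => ⟨⟨x, h.1, h.2⟩, rfl⟩⟩
  rw [this]
  exact (isClosed_eq (by fun_prop) (by fun_prop)).inter (isClosed_eq (by fun_prop) (by fun_prop))

theorem countablyCompactSpace [CountablyCompactSpace S] :
    CountablyCompactSpace (MaximalSubgroup f) := by
  refine ⟨isCountablyCompact_iff_seq_clusterPt.2 fun u _ => ?_⟩
  obtain ⟨_, ⟨y, rfl⟩, hy⟩ :=
    (isClosedEmbedding_val (f := f)).isClosed_range.isCountablyCompact.seq_clusterPt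
      (fun n => (u n).val) (.of_forall fun n => ⟨u n, rfl⟩)
  exact ⟨y, trivial, isClosedEmbedding_val.isInducing.mapClusterPt_iff.1 hy⟩

end MaximalSubgroup

end InverseSemigroup

/-! ### Transfer of topological inverse semigroup structure -/

theorem isSemigroupInverse_iff_eq_inv {G : Type*} [Group G] {x y : G} :
    IsSemigroupInverse x y ↔ y = x⁻¹ := by
  constructor
  · rintro ⟨h, -⟩
    have : x * y = 1 := by simpa using h
    exact (inv_eq_of_mul_eq_one_right this).symm
  · rintro rfl
    simp [IsSemigroupInverse]

theorem IsTopologicalGroup.isTopologicalInverseSemigroup {G : Type*} [Group G] [TopologicalSpace G]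
    [IsTopologicalGroup G] [T2Space G] : IsTopologicalInverseSemigroup G where
  t2 := inferInstance
  inverse x := ⟨x⁻¹, isSemigroupInverse_iff_eq_inv.2 rfl,
    fun _ h => isSemigroupInverse_iff_eq_inv.1 h⟩
  continuous_mul := continuous_mul
  continuous_inv := ⟨_, fun _ => isSemigroupInverse_iff_eq_inv.2 rfl, continuous_inv⟩

theorem IsSemigroupInverse.map {S T : Type*} [Semigroup S] [Semigroup T] (φ : S ≃* T) {x y : S}
    (h : IsSemigroupInverse x y) : IsSemigroupInverse (φ x) (φ y) := by
  constructor
  · rw [← map_mul, ← map_mul, h.1]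
  · rw [← map_mul, ← map_mul, h.2]

theorem IsTopologicalInverseSemigroup.of_continuousMulEquiv {S T : Type*} [Semigroup S]
    [Semigroup T] [TopologicalSpace S] [TopologicalSpace T] (φ : S ≃ₜ* T)
    (hS : IsTopologicalInverseSemigroup S) : IsTopologicalInverseSemigroup T where
  t2 := by
    have := hS.t2
    exact φ.toHomeomorph.t2Space
  inverse x := by
    obtain ⟨y, hy, hu⟩ := hS.inverse (φ.symm x)
    refine ⟨φ y, ?_, fun z hz => ?_⟩
    · exact φ.apply_symm_apply x ▸ hy.map φ.toMulEquiv
    · exact hu (φ.symm z) (hz.map φ.symm.toMulEquiv) ▸ (φ.apply_symm_apply z).symm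
  continuous_mul := by
    have h := φ.continuous.comp (hS.continuous_mul.comp
      (φ.symm.continuous.prodMap φ.symm.continuous))
    convert h using 2 with p
    exact ((map_mul φ _ _).trans
      (congrArg₂ _ (φ.apply_symm_apply p.1) (φ.apply_symm_apply p.2))).symm
  continuous_inv := by
    obtain ⟨i, hi, hc⟩ := hS.continuous_inv
    refine ⟨fun x => φ (i (φ.symm x)), fun x => ?_,
      φ.continuous.comp (hc.comp φ.symm.continuous)⟩
    have h : IsSemigroupInverse (φ (φ.symm x)) (φ (i (φ.symm x))) :=
      (hi (φ.symm x)).map φ.toMulEquiv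
    rwa [φ.apply_symm_apply] at h

namespace BrandtExt

/-- The Brandt extension as a disjoint union of copies of `M` and a point. -/
def equivSum (I M : Type*) : (Σ _ : I × I, M) ⊕ PUnit.{1} ≃ BrandtExt I M where
  toFun x := match x with
    | .inl ⟨(i, j), a⟩ => triple i a j
    | .inr _ => zero
  invFun x := match x with
    | triple i a j => .inl ⟨(i, j), a⟩
    | zero => .inr ⟨⟩
  left_inv := by rintro (⟨⟨i, j⟩, a⟩ | _) <;> rfl
  right_inv := by rintro (_ | ⟨i, a, j⟩) <;> rfl

theorem triple_mul_triple {I M : Type*} [Monoid M] (i j l : I) (a b : M) :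
    triple i a j * triple j b l = triple i (a * b) l :=
  if_pos rfl

theorem triple_mul_triple_of_ne {I M : Type*} [Monoid M] (i l : I) {j k : I} (h : j ≠ k)
    (a b : M) : triple i a j * triple k b l = 0 :=
  if_neg h

end BrandtExt

/-! ### Brandt coordinates -/

namespace InverseSemigroup

variable {S : Type*} [SemigroupWithZero S] [Inv S]

/-- Elements `r i` with common left idempotent `f` and pairwise orthogonal right idempotents that
exhaust the nonzero idempotents. -/
structure BrandtFrame (I : Type*) (S : Type*) [SemigroupWithZero S] [Inv S] where
  /-- The base idempotent. -/
  f : {e : S // e * e = e}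
  /-- The connecting elements. -/
  r : I → S
  ne_zero : (f : S) ≠ 0
  mul_inv : ∀ i, r i * (r i)⁻¹ = f
  mul_inv_of_ne : ∀ i j, i ≠ j → r i * (r j)⁻¹ = 0
  surj : ∀ e : S, e * e = e → e ≠ 0 → ∃ i, (r i)⁻¹ * r i = e

namespace BrandtFrame

variable {I : Type*} (F : BrandtFrame I S)

/-- The map from the Brandt extension given by the connecting elements. -/
def toFun : BrandtExt I (MaximalSubgroup F.f) → S
  | .zero => 0
  | .triple i h j => (F.r i)⁻¹ * h.val * F.r j

/-- Compression by `r i` and `r j` kills every other block, which separates the blocks algebraically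
and topologically. -/
theorem mul_toFun_mul_of_ne {i j k l : I} (h : MaximalSubgroup F.f) (hne : (i, j) ≠ (k, l)) :
    F.r i * F.toFun (.triple k h l) * (F.r j)⁻¹ = 0 := by
  have : F.r i * F.toFun (.triple k h l) * (F.r j)⁻¹
      = F.r i * (F.r k)⁻¹ * h.val * (F.r l * (F.r j)⁻¹) := by simp only [toFun, mul_assoc]
  rw [this]
  by_cases hik : i = k
  · rw [F.mul_inv_of_ne l j fun hlj => hne (by rw [hik, hlj]), mul_zero]
  · rw [F.mul_inv_of_ne i k hik, zero_mul, zero_mul]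

theorem val_ne_zero (h : MaximalSubgroup F.f) : h.val ≠ 0 := fun h0 =>
  F.ne_zero (by rw [← h.mul_inv, h0, zero_mul])

theorem continuous_triple [TopologicalSpace S] [ContinuousMul S] (i j : I) :
    Continuous fun h : MaximalSubgroup F.f => F.toFun (.triple i h j) := by
  simp only [toFun]
  fun_prop

variable [InverseSemigroup S]

theorem toFun_mul (x y : BrandtExt I (MaximalSubgroup F.f)) :
    F.toFun (x * y) = F.toFun x * F.toFun y := by
  rcases x with _ | ⟨i, a, j⟩
  · exact (zero_mul _).symm
  rcases y with _ | ⟨k, b, l⟩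
  · exact (mul_zero _).symm
  have h : F.toFun (.triple i a j) * F.toFun (.triple k b l) =
      (F.r i)⁻¹ * a.val * (F.r j * (F.r k)⁻¹) * b.val * F.r l := by
    simp only [toFun, mul_assoc]
  rw [h]
  by_cases hjk : j = k
  · subst hjk
    rw [BrandtExt.triple_mul_triple, F.mul_inv, mul_assoc _ a.val, a.mul_idem]
    simp only [toFun, MaximalSubgroup.val_mul, mul_assoc]
  · rw [BrandtExt.triple_mul_triple_of_ne _ _ hjk, F.mul_inv_of_ne j k hjk]
    simp only [mul_zero, zero_mul]
    rfl

theorem mul_toFun_mul (i j : I) (h : MaximalSubgroup F.f) :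
    F.r i * F.toFun (.triple i h j) * (F.r j)⁻¹ = h.val := by
  calc F.r i * F.toFun (.triple i h j) * (F.r j)⁻¹
      = F.r i * (F.r i)⁻¹ * h.val * (F.r j * (F.r j)⁻¹) := by simp only [toFun, mul_assoc]
    _ = h.val := by rw [F.mul_inv, F.mul_inv, h.idem_mul, h.mul_idem]

theorem toFun_injective : Function.Injective F.toFun := by
  have hz : ∀ i h j, F.toFun (.triple i h j) ≠ 0 := fun i h j h0 =>
    F.val_ne_zero h (by rw [← F.mul_toFun_mul i j, h0, mul_zero, zero_mul])
  rintro (_ | ⟨i, a, j⟩) (_ | ⟨k, b, l⟩) h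
  · rfl
  · exact absurd h.symm (hz _ _ _)
  · exact absurd h (hz _ _ _)
  · have ha := F.mul_toFun_mul i j a
    by_cases hne : (i, j) = (k, l)
    · obtain ⟨rfl, rfl⟩ := Prod.mk.inj hne
      rw [h, F.mul_toFun_mul] at ha
      rw [MaximalSubgroup.val_injective ha]
    · rw [h, F.mul_toFun_mul_of_ne b hne] at ha
      exact absurd ha.symm (F.val_ne_zero a)

theorem r_mul_inv_mul (i : I) : F.r i * ((F.r i)⁻¹ * F.r i) = F.r i := by
  rw [← mul_assoc, mul_inv_mul]

theorem mul_mul_mem {x : S} {i j : I} (hi : (F.r i)⁻¹ * F.r i = x * x⁻¹)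
    (hj : (F.r j)⁻¹ * F.r j = x⁻¹ * x) :
    F.r i * x * (F.r j)⁻¹ * (F.r i * x * (F.r j)⁻¹)⁻¹ = F.f ∧
      (F.r i * x * (F.r j)⁻¹)⁻¹ * (F.r i * x * (F.r j)⁻¹) = F.f := by
  rw [mul_inv_rev', mul_inv_rev', inv_inv']
  constructor
  · calc F.r i * x * (F.r j)⁻¹ * (F.r j * (x⁻¹ * (F.r i)⁻¹))
        = F.r i * (x * ((F.r j)⁻¹ * F.r j) * x⁻¹) * (F.r i)⁻¹ := by simp only [mul_assoc]
      _ = F.f := by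
        rw [hj, ← mul_assoc x, mul_inv_mul, ← hi, r_mul_inv_mul, F.mul_inv]
  · calc F.r j * (x⁻¹ * (F.r i)⁻¹) * (F.r i * x * (F.r j)⁻¹)
        = F.r j * (x⁻¹ * ((F.r i)⁻¹ * F.r i) * x) * (F.r j)⁻¹ := by simp only [mul_assoc]
      _ = F.f := by
        rw [hi, ← mul_assoc x⁻¹, inv_mul_inv, ← hj, r_mul_inv_mul, F.mul_inv]

theorem toFun_surjective : Function.Surjective F.toFun := by
  intro x
  by_cases hx : x = 0
  · exact ⟨.zero, hx.symm⟩
  obtain ⟨i, hi⟩ := F.surj (x * x⁻¹) (mul_inv_idem x)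
    fun h => hx (by rw [← mul_inv_mul x, h, zero_mul])
  obtain ⟨j, hj⟩ := F.surj (x⁻¹ * x) (inv_mul_idem x)
    fun h => hx (by rw [← mul_inv_mul x, mul_assoc, h, mul_zero])
  have hm := F.mul_mul_mem hi hj
  refine ⟨.triple i ⟨_, hm.1, hm.2⟩ j, ?_⟩
  calc (F.r i)⁻¹ * (F.r i * x * (F.r j)⁻¹) * F.r j
      = (F.r i)⁻¹ * F.r i * x * ((F.r j)⁻¹ * F.r j) := by simp only [mul_assoc]
    _ = x := by rw [hi, hj, mul_inv_mul, ← mul_assoc, mul_inv_mul]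

/-- The isomorphism of the Brandt extension with the semigroup. -/
noncomputable def mulEquiv : BrandtExt I (MaximalSubgroup F.f) ≃* S :=
  MulEquiv.ofBijective (⟨F.toFun, F.toFun_mul⟩ : BrandtExt I (MaximalSubgroup F.f) →ₙ* S)
    ⟨F.toFun_injective, F.toFun_surjective⟩

variable [TopologicalSpace S] [ContinuousMul S]

theorem isEmbedding_triple (i j : I) :
    IsEmbedding fun h : MaximalSubgroup F.f => F.toFun (.triple i h j) := by
  refine IsEmbedding.of_comp (F.continuous_triple i j)
    (g := fun x => F.r i * x * (F.r j)⁻¹) (by fun_prop) ?_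
  convert MaximalSubgroup.isEmbedding_val (f := F.f) using 1
  exact funext (F.mul_toFun_mul i j)

variable [ContinuousInv S] [T2Space S]

/-- The image of `A` is the preimage of the closed set `val '' A` under compression: other blocks
and `0` go to `0`, which is not in `H`. -/
theorem isClosedMap_triple (i j : I) :
    IsClosedMap fun h : MaximalSubgroup F.f => F.toFun (.triple i h j) := by
  intro A hA
  have hval : IsClosed (MaximalSubgroup.val '' A) :=
    MaximalSubgroup.isClosedEmbedding_val.isClosedMap A hA
  have : (fun h : MaximalSubgroup F.f => F.toFun (.triple i h j)) '' A =
      (fun x => F.r i * x * (F.r j)⁻¹) ⁻¹' (MaximalSubgroup.val '' A) := by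
    ext x
    constructor
    · rintro ⟨h, hA, rfl⟩
      exact ⟨h, hA, (F.mul_toFun_mul i j h).symm⟩
    · rintro ⟨h, hA, hx⟩
      obtain ⟨y, rfl⟩ := F.toFun_surjective x
      rcases y with _ | ⟨k, b, l⟩
      · exact absurd (by simpa [toFun] using hx) (F.val_ne_zero h)
      · beta_reduce at hx
        by_cases hne : (i, j) = (k, l)
        · obtain ⟨rfl, rfl⟩ := Prod.mk.inj hne
          rw [F.mul_toFun_mul] at hx
          exact ⟨h, hA, by rw [MaximalSubgroup.val_injective hx]⟩
        · rw [F.mul_toFun_mul_of_ne b hne] at hx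
          exact absurd hx (F.val_ne_zero h)
  rw [this]
  exact hval.preimage (by fun_prop)

/-- The decomposition of the semigroup as a topological sum. -/
noncomputable def homeomorphSum [Finite I] :
    (Σ _ : I × I, MaximalSubgroup F.f) ⊕ PUnit.{1} ≃ₜ S :=
  ((BrandtExt.equivSum I _).trans F.mulEquiv.toEquiv).toHomeomorphOfContinuousClosed
    (continuous_sum_dom.2 ⟨continuous_sigma fun p => F.continuous_triple p.1 p.2,
      continuous_const⟩) <| isClosedMap_sum.2 ⟨by
    intro A hA
    rw [isClosed_sigma_iff] at hA
    have : (fun a => ((BrandtExt.equivSum I _).trans F.mulEquiv.toEquiv) (Sum.inl a)) '' A =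
        ⋃ p : I × I, (fun h => F.toFun (.triple p.1 h p.2)) '' ((fun h => ⟨p, h⟩) ⁻¹' A) := by
      ext x
      simp only [Set.mem_image, Set.mem_iUnion]
      exact ⟨fun ⟨⟨p, h⟩, hA, hx⟩ => ⟨p, h, hA, hx⟩, fun ⟨p, h, hA, hx⟩ => ⟨⟨p, h⟩, hA, hx⟩⟩
    rw [this]
    exact isClosed_iUnion_of_finite fun p => F.isClosedMap_triple p.1 p.2 _ (hA p),
    fun A _ => (Set.toFinite _).isClosed⟩

end BrandtFrame

variable [InverseSemigroup S] [TopologicalSpace S] [T2Space S] [CountablyCompactSpace S]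
  [ContinuousMul S] [ContinuousInv S]

theorem exists_brandtFrame (h0 : IsZeroSimple S) :
    ∃ n : ℕ, Nonempty (Fin n) ∧ Nonempty (BrandtFrame (Fin n) S) := by
  have hfin : Finite {e : S | e * e = e ∧ e ≠ 0} := (finite_nonzero_idem h0).to_subtype
  obtain ⟨n, ⟨φ⟩⟩ := Finite.exists_equiv_fin {e : S | e * e = e ∧ e ≠ 0}
  obtain ⟨x, y, hxy⟩ := h0.1
  have hx : x ≠ 0 := fun h => hxy (by rw [h, zero_mul])
  have hf0 : x * x⁻¹ ≠ 0 := fun h => hx (by rw [← mul_inv_mul x, h, zero_mul])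
  choose r hr hre using fun i => exists_mul_inv_eq_and_inv_mul_eq h0 (φ.symm i).2.1
    (mul_inv_idem x) (φ.symm i).2.2 hf0
  refine ⟨n, ⟨φ ⟨_, mul_inv_idem x, hf0⟩⟩, ⟨⟨⟨_, mul_inv_idem x⟩, r, hf0, hr, fun i j hij => ?_,
    fun e he he0 => ⟨φ ⟨e, he, he0⟩, by rw [hre, φ.symm_apply_apply]⟩⟩⟩⟩
  have hne : ((φ.symm i : _) : S) ≠ φ.symm j :=
    fun h => hij (φ.symm.injective (Subtype.ext h))
  -- Insert the right idempotents of `r i` and `r j` between the factors; they are orthogonal.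
  rw [← mul_inv_mul (r i), ← inv_mul_inv (r j), mul_assoc (r i), hre, hre, mul_assoc,
    ← mul_assoc _ _ (r j)⁻¹, idem_mul_eq_zero h0 (φ.symm i).2.1 (φ.symm j).2.1 hne, zero_mul,
    mul_zero]

end InverseSemigroup

/-! ### The structure theorem -/

open InverseSemigroup in
theorem theorem2 (S : Type u) [SemigroupWithZero S] [TopologicalSpace S]
    [CountablyCompactSpace S] (hS : IsTopologicalInverseSemigroup S) (h0 : IsZeroSimple S) :
    ∃ (I : Type) (_ : Finite I) (_ : Nonempty I)
      (H : Type u) (_ : Group H) (_ : TopologicalSpace H) (_ : TopologicalSpace (BrandtExt I H)),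
      IsTopologicalGroup H ∧ T2Space H ∧ CountablyCompactSpace H ∧
      IsTopologicalBrandtExt I H ∧
      Nonempty (S ≃ₜ* BrandtExt I H) ∧
      Nonempty (S ≃ₜ ((Σ _ : I × I, H) ⊕ PUnit.{1})) := by
  obtain ⟨inv, hinv, hinvc⟩ := hS.continuous_inv
  let : Inv S := ⟨inv⟩
  have : T2Space S := hS.t2
  have : ContinuousMul S := ⟨hS.continuous_mul⟩
  have : ContinuousInv S := ⟨hinvc⟩
  have : InverseSemigroup S := ⟨fun x => (hinv x).1, fun x => (hinv x).2,
    fun x y h1 h2 => (hS.inverse x).unique ⟨h1, h2⟩ (hinv x)⟩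
  obtain ⟨n, ⟨i⟩, ⟨F⟩⟩ := exists_brandtFrame h0
  -- The topology is pulled back from `S`, so the algebraic isomorphism is a homeomorphism.
  let : TopologicalSpace (BrandtExt (Fin n) (MaximalSubgroup F.f)) := .induced F.mulEquiv ‹_›
  have hind : IsInducing F.mulEquiv := ⟨rfl⟩
  let Φ : BrandtExt (Fin n) (MaximalSubgroup F.f) ≃ₜ* S :=
    { F.mulEquiv, F.mulEquiv.toEquiv.toHomeomorphOfIsInducing hind with }
  have hG : IsTopologicalGroup (MaximalSubgroup F.f) := MaximalSubgroup.isTopologicalGroup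
  have hT : T2Space (MaximalSubgroup F.f) := MaximalSubgroup.t2Space
  exact ⟨Fin n, inferInstance, ⟨i⟩, MaximalSubgroup F.f, inferInstance, inferInstance,
    inferInstance, hG, hT, MaximalSubgroup.countablyCompactSpace,
    ⟨IsTopologicalGroup.isTopologicalInverseSemigroup, hS.of_continuousMulEquiv Φ.symm,
      i, (IsEmbedding.of_comp_iff ⟨hind, F.mulEquiv.injective⟩).1 (F.isEmbedding_triple i i)⟩, ⟨Φ.symm⟩,
    ⟨F.homeomorphSum.symm⟩⟩
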